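/- **Theorem 3.2 (Krammer).** For $n\ge 1$ let $B_n$ be the braid group, i.e. the group generated by $\sigma_1,\dots,\sigma_{n-1}$ subject to $\sigma_i\sigma_j=\sigma_j\sigma_i$ for $|i-j|\ge 2$ and $\sigma_i\sigma_{i+1}\sigma_i=\sigma_{i+1}\sigma_i\sigma_{i+1}$ for $1\le i\le n-2$. For a commutative ring $R$ and invertible elements $q,t\in R$, let $V$ be the free $R$-module with basis $\{x_{i,j} : 1\le i<j\le n\}$, and let $\rho_{q,t}\colon B_n\to \mathrm{Aut}_R(V)$ be the (well-defined) representation given by $$ \sigma_k(x_{i,j})=\begin{cases} x_{i,j} & k<i-1 \text{ or } j<k,\\ x_{i-1,j}+(1-q)x_{i,j} & k=i-1,\\ tq(q-1)x_{i,i+1}+q\,x_{i+1,j} & k=i<j-1,\\ tq^2x_{i,j} & k=i=j-1,\\ x_{i,j}+tq^{k-i}(q-1)^2x_{k,k+1} & i<k<j-1,\\ x_{i,j-1}+tq^{j-i}(q-1)x_{j-1,j} & i<k=j-1,\\ (1-q)x_{i,j}+q\,x_{i,j+1} & k=j.\end{cases} $$ Then for every $n\ge 1$: 1. if $R=\mathbb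 R[t^{\pm1}]$ and $q\in\mathbb R$ with $0<q<1$, the representation $\rho_{q,t}\colon B_n\to\mathrm{Aut}_R(V)$ is faithful (injective); 2. consequently, for $R=\mathbb Z[q^{\pm1},t^{\pm1}]$, the ring of Laurent polynomials in two variables $q,t$, the representation $\rho_{q,t}\colon B_n\to\mathrm{Aut}_R(V)$ is faithful. -/

import Mathlib

open scoped LaurentPolynomial

namespace Krammer

/-! ### The braid group -/

/-- The defining relators of the braid group on `n` strings. The index `k : Fin (n - 1)` stands for
the generator `σ_{k+1}` in the usual numbering `σ_1, …, σ_{n-1}`. -/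
def braidRels (n : ℕ) : Set (FreeGroup (Fin (n - 1))) :=
  {r | ∃ i j : Fin (n - 1), ((i : ℕ) + 2 ≤ j ∨ (j : ℕ) + 2 ≤ i) ∧
      r = (FreeGroup.of i * FreeGroup.of j) * (FreeGroup.of j * FreeGroup.of i)⁻¹} ∪
  {r | ∃ i j : Fin (n - 1), (i : ℕ) + 1 = j ∧
      r = (FreeGroup.of i * FreeGroup.of j * FreeGroup.of i) *
        (FreeGroup.of j * FreeGroup.of i * FreeGroup.of j)⁻¹}

/-- The braid group `B_n`, given by Artin's presentation. -/
abbrev BraidGroup (n : ℕ) : Type := PresentedGroup (braidRels n)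

/-- The generator `σ_{k+1}` of `B_n`. -/
def BraidGroup.sigma {n : ℕ} (k : Fin (n - 1)) : BraidGroup n := PresentedGroup.of k

/-! ### The module `V` -/

/-- The set of pairs of integers `(i, j)` with `1 ≤ i < j ≤ n`. -/
abbrev Ref (n : ℕ) : Type := {s : ℕ × ℕ // 1 ≤ s.1 ∧ s.1 < s.2 ∧ s.2 ≤ n}

/-- The free `R`-module `V` with basis `x_{i,j}`, `1 ≤ i < j ≤ n`. -/
abbrev V (n : ℕ) (R : Type*) [CommRing R] : Type _ := Ref n →₀ R

section

variable {R : Type*} [CommRing R]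

/-- The basis vector `x_{i,j}` for `1 ≤ i < j ≤ n`. (For other `i, j` the value is `0`; such
vectors never occur in the action below.) -/
noncomputable def x (n : ℕ) (R : Type*) [CommRing R] (i j : ℕ) : V n R :=
  if h : 1 ≤ i ∧ i < j ∧ j ≤ n then Finsupp.single ⟨(i, j), h⟩ 1 else 0

/-- The vector `σ_k(x_{i,j})`, for `1 ≤ k ≤ n - 1` and `1 ≤ i < j ≤ n`. -/
noncomputable def sigmaX (n : ℕ) (q t : R) (k i j : ℕ) : V n R :=
  if k + 1 < i ∨ j < k then x n R i j
  else if k + 1 = i then x n R (i - 1) j + (1 - q) • x n R i j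
  else if k = i ∧ k + 1 < j then (t * q * (q - 1)) • x n R i (i + 1) + q • x n R (i + 1) j
  else if k = i ∧ k + 1 = j then (t * q ^ 2) • x n R i j
  else if i < k ∧ k + 1 < j then x n R i j + (t * q ^ (k - i) * (q - 1) ^ 2) • x n R k (k + 1)
  else if k + 1 = j then x n R i (j - 1) + (t * q ^ (j - i) * (q - 1)) • x n R (j - 1) j
  else (1 - q) • x n R i j + q • x n R i (j + 1)

/-- The `R`-linear endomorphism of `V` sending each `x_{i,j}` to `σ_k(x_{i,j})`. -/
noncomputable def sigmaLin (n : ℕ) (q t : R) (k : ℕ) : V n R →ₗ[R] V n R :=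
  Finsupp.linearCombination R fun s : Ref n => sigmaX n q t k s.1.1 s.1.2

theorem sigmaLin_x (n : ℕ) (q t : R) (k : ℕ) {i j : ℕ} (hi : 1 ≤ i) (hij : i < j) (hj : j ≤ n) :
    sigmaLin n q t k (x n R i j) = sigmaX n q t k i j := by
  simp [sigmaLin, x, hi, hij, hj]

theorem hom_ext_x (n : ℕ) {f g : V n R →ₗ[R] V n R}
    (h : ∀ i j, 1 ≤ i → i < j → j ≤ n → f (x n R i j) = g (x n R i j)) : f = g := by
  ext1 ⟨⟨i, j⟩, hs⟩
  ext1
  have := h i j hs.1 hs.2.1 hs.2.2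
  simpa [x, hs] using this

section

variable (n : ℕ) (q t : R)

theorem sl_far {k i j : ℕ} (hi : 1 ≤ i) (hij : i < j) (hj : j ≤ n) (h : k + 1 < i ∨ j < k) :
    sigmaLin n q t k (x n R i j) = x n R i j := by
  rw [sigmaLin_x n q t k hi hij hj, sigmaX, if_pos h]

theorem sl_a {k j : ℕ} (hij : k + 1 < j) (hj : j ≤ n) :
    sigmaLin n q t k (x n R (k + 1) j) = x n R k j + (1 - q) • x n R (k + 1) j := by
  rw [sigmaLin_x n q t k (by omega) hij hj, sigmaX, if_neg (by omega), if_pos (by omega)]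
  rfl

theorem sl_b {k j : ℕ} (hk : 1 ≤ k) (hij : k + 1 < j) (hj : j ≤ n) :
    sigmaLin n q t k (x n R k j) =
      (t * q * (q - 1)) • x n R k (k + 1) + q • x n R (k + 1) j := by
  rw [sigmaLin_x n q t k hk (by omega) hj, sigmaX, if_neg (by omega), if_neg (by omega),
    if_pos (by omega)]

theorem sl_c {k : ℕ} (hk : 1 ≤ k) (hj : k + 1 ≤ n) :
    sigmaLin n q t k (x n R k (k + 1)) = (t * q ^ 2) • x n R k (k + 1) := by
  rw [sigmaLin_x n q t k hk (by omega) hj, sigmaX, if_neg (by omega), if_neg (by omega),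
    if_neg (by omega), if_pos (by omega)]

theorem sl_d {k i j : ℕ} (hi : 1 ≤ i) (hik : i < k) (hkj : k + 1 < j) (hj : j ≤ n) :
    sigmaLin n q t k (x n R i j) =
      x n R i j + (t * q ^ (k - i) * (q - 1) ^ 2) • x n R k (k + 1) := by
  rw [sigmaLin_x n q t k hi (by omega) hj, sigmaX, if_neg (by omega), if_neg (by omega),
    if_neg (by omega), if_neg (by omega), if_pos (by omega)]

theorem sl_e {k i : ℕ} (hi : 1 ≤ i) (hik : i < k) (hj : k + 1 ≤ n) :
    sigmaLin n q t k (x n R i (k + 1)) =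
      x n R i k + (t * q ^ (k + 1 - i) * (q - 1)) • x n R k (k + 1) := by
  rw [sigmaLin_x n q t k hi (by omega) hj, sigmaX, if_neg (by omega), if_neg (by omega),
    if_neg (by omega), if_neg (by omega), if_neg (by omega), if_pos (by omega)]
  rfl

theorem sl_f {k i : ℕ} (hi : 1 ≤ i) (hik : i < k) (hj : k + 1 ≤ n) :
    sigmaLin n q t k (x n R i k) = (1 - q) • x n R i k + q • x n R i (k + 1) := by
  rw [sigmaLin_x n q t k hi (by omega) (by omega), sigmaX, if_neg (by omega), if_neg (by omega),
    if_neg (by omega), if_neg (by omega), if_neg (by omega), if_neg (by omega)]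

/-- The seven possible positions of `k` relative to `i < j`. -/
theorem pos_cases (k i j : ℕ) (hij : i < j) :
    (k + 1 < i ∨ j < k) ∨ i = k + 1 ∨ (i = k ∧ k + 1 < j) ∨ (i = k ∧ j = k + 1) ∨
      (i < k ∧ k + 1 < j) ∨ (i < k ∧ j = k + 1) ∨ (i < k ∧ j = k) := by
  omega

theorem sigma_comm {k l : ℕ} (hk : 1 ≤ k) (hkl : k + 2 ≤ l) (hl : l + 1 ≤ n) :
    sigmaLin n q t k ∘ₗ sigmaLin n q t l = sigmaLin n q t l ∘ₗ sigmaLin n q t k := by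
  apply hom_ext_x
  intro i j hi hij hj
  simp only [LinearMap.comp_apply]
  obtain ⟨d, hd⟩ : ∃ d, l = k + 2 + d := ⟨l - (k + 2), by omega⟩
  have e1 : l - k = d + 2 := by omega
  have e2 : l - (k + 1) = d + 1 := by omega
  have e3 : l + 1 - k = d + 3 := by omega
  have e4 : l + 1 - (k + 1) = d + 2 := by omega
  clear hd
  rcases pos_cases k i j hij with h | rfl | ⟨rfl, h⟩ | ⟨rfl, rfl⟩ | ⟨h, h'⟩ | ⟨h, rfl⟩ | ⟨h, rfl⟩ <;>
  rcases pos_cases l _ _ hij with g | g | ⟨g, g'⟩ | ⟨g, g'⟩ | ⟨g, g'⟩ | ⟨g, g'⟩ | ⟨g, g'⟩ <;>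
  first
  | omega
  | (try subst g
     try subst g'
     simp (disch := omega) only [map_add, map_smul, sl_far, sl_a, sl_b, sl_c, sl_d, sl_e, sl_f,
       e1, e2, e3, e4]
     try module)

theorem sigma_braid {k : ℕ} (hk : 1 ≤ k) (hl : k + 2 ≤ n) :
    sigmaLin n q t k ∘ₗ sigmaLin n q t (k + 1) ∘ₗ sigmaLin n q t k =
      sigmaLin n q t (k + 1) ∘ₗ sigmaLin n q t k ∘ₗ sigmaLin n q t (k + 1) := by
  apply hom_ext_x
  intro i j hi hij hj
  simp only [LinearMap.comp_apply]
  have e1 : ∀ a : ℕ, a + 1 - a = 1 := by omega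
  have e2 : ∀ a : ℕ, a + 1 + 1 - a = 2 := by omega
  obtain ⟨d, e3, e4, e5⟩ : ∃ d, (i < k → k - i = d) ∧ (i < k → k + 1 - i = d + 1) ∧
      (i < k → k + 1 + 1 - i = d + 2) := ⟨k - i, by omega, by omega, by omega⟩
  obtain ⟨k', hk'⟩ : ∃ k', k' = k := ⟨k, rfl⟩
  rcases pos_cases k i j hij with h | rfl | ⟨rfl, h⟩ | ⟨rfl, rfl⟩ | ⟨h, h'⟩ | ⟨h, rfl⟩ | ⟨h, rfl⟩
  all_goals rcases pos_cases (k' + 1) _ _ hij with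
      g | g | ⟨g, g'⟩ | ⟨g, g'⟩ | ⟨g, g'⟩ | ⟨g, g'⟩ | ⟨g, g'⟩ <;>
  first
  | omega
  | (subst hk'
     try subst g
     try subst g'
     simp (disch := omega) only [map_add, map_smul, sl_far, sl_a, sl_b, sl_c, sl_d, sl_e, sl_f,
       e1, e2, e3, e4, e5]
     try module)

/-- The cubic relation satisfied by `σ_k`, which shows that `σ_k` is invertible. -/
theorem sigma_cubic {k : ℕ} (hk : 1 ≤ k) (hl : k + 1 ≤ n) (v : V n R) :
    sigmaLin n q t k (sigmaLin n q t k (sigmaLin n q t k v)) =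
      (1 - q + t * q ^ 2) • sigmaLin n q t k (sigmaLin n q t k v) +
      (q - t * q ^ 2 + t * q ^ 3) • sigmaLin n q t k v - (t * q ^ 3) • v := by
  suffices h : sigmaLin n q t k ∘ₗ sigmaLin n q t k ∘ₗ sigmaLin n q t k =
      (1 - q + t * q ^ 2) • (sigmaLin n q t k ∘ₗ sigmaLin n q t k) +
      (q - t * q ^ 2 + t * q ^ 3) • sigmaLin n q t k - (t * q ^ 3) • LinearMap.id by
    simpa using congrArg (fun f => f v) h
  apply hom_ext_x
  intro i j hi hij hj
  simp only [LinearMap.comp_apply, LinearMap.add_apply, LinearMap.sub_apply, LinearMap.smul_apply,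
    LinearMap.id_apply]
  obtain ⟨d, e3, e4⟩ : ∃ d, (i < k → k - i = d) ∧ (i < k → k + 1 - i = d + 1) :=
    ⟨k - i, by omega, by omega⟩
  rcases pos_cases k i j hij with h | rfl | ⟨rfl, h⟩ | ⟨rfl, rfl⟩ | ⟨h, h'⟩ | ⟨h, rfl⟩ | ⟨h, rfl⟩ <;>
    simp (disch := omega) only [map_add, map_smul, sl_far, sl_a, sl_b, sl_c, sl_d, sl_e, sl_f,
      e3, e4] <;>
    module

end

/-! ### The representation -/

/-- The automorphism of `V` given by `σ_k`, for invertible `q` and `t`. -/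
noncomputable def sigmaEquiv (n : ℕ) (q t : Rˣ) (k : ℕ) (hk : 1 ≤ k) (hl : k + 1 ≤ n) :
    V n R ≃ₗ[R] V n R :=
  LinearEquiv.ofBijective (sigmaLin n (q : R) (t : R) k) (by
    have hc := sigma_cubic n (q : R) (t : R) hk hl
    have hu : ∀ w : V n R, ((t * q ^ 3)⁻¹ : Rˣ) • ((t : R) * (q : R) ^ 3) • w = w := by
      intro w
      rw [Units.smul_def, smul_smul, ← Units.val_pow_eq_pow_val, ← Units.val_mul, ← Units.val_mul,
        inv_mul_cancel, Units.val_one, one_smul]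
    constructor
    · rw [← LinearMap.ker_eq_bot, LinearMap.ker_eq_bot']
      intro v hv
      have h := hc v
      simp only [hv, map_zero, smul_zero, zero_add, zero_sub] at h
      have h' : ((t : R) * (q : R) ^ 3) • v = 0 := by simpa using h.symm
      rw [← hu v, h', smul_zero]
    · intro v
      refine ⟨((t * q ^ 3)⁻¹ : Rˣ) • ((1 - (q : R) + t * q ^ 2) • sigmaLin n (q : R) (t : R) k v +
        ((q : R) - t * q ^ 2 + t * q ^ 3) • v -
          sigmaLin n (q : R) (t : R) k (sigmaLin n (q : R) (t : R) k v)), ?_⟩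
      conv_rhs => rw [← hu v]
      rw [Units.smul_def, Units.smul_def, map_smul, map_sub, map_add, map_smul, map_smul, hc v]
      congr 1
      abel)

theorem sigmaEquiv_apply (n : ℕ) (q t : Rˣ) (k : ℕ) (hk : 1 ≤ k) (hl : k + 1 ≤ n) (v : V n R) :
    sigmaEquiv n q t k hk hl v = sigmaLin n (q : R) (t : R) k v := rfl

theorem sigmaEquiv_comm (n : ℕ) (q t : Rˣ) {k l : ℕ} (hk : 1 ≤ k) (hk' : k + 1 ≤ n)
    (hl : 1 ≤ l) (hl' : l + 1 ≤ n) (hkl : k + 2 ≤ l) :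
    sigmaEquiv n q t k hk hk' * sigmaEquiv n q t l hl hl' =
      sigmaEquiv n q t l hl hl' * sigmaEquiv n q t k hk hk' :=
  LinearEquiv.ext fun v => LinearMap.congr_fun (sigma_comm n (q : R) (t : R) hk hkl hl') v

theorem sigmaEquiv_braid (n : ℕ) (q t : Rˣ) {k l : ℕ} (hk : 1 ≤ k) (hk' : k + 1 ≤ n)
    (hl : 1 ≤ l) (hl' : l + 1 ≤ n) (hkl : k + 1 = l) :
    sigmaEquiv n q t k hk hk' * sigmaEquiv n q t l hl hl' * sigmaEquiv n q t k hk hk' =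
      sigmaEquiv n q t l hl hl' * sigmaEquiv n q t k hk hk' * sigmaEquiv n q t l hl hl' := by
  subst hkl
  exact LinearEquiv.ext fun v => LinearMap.congr_fun (sigma_braid n (q : R) (t : R) hk hl') v

theorem sigmaEquiv_rels (n : ℕ) (q t : Rˣ) (r : FreeGroup (Fin (n - 1))) (hr : r ∈ braidRels n) :
    FreeGroup.lift (fun k : Fin (n - 1) =>
      sigmaEquiv n q t ((k : ℕ) + 1) (by omega) (by omega)) r = 1 := by
  obtain ⟨i, j, h, rfl⟩ | ⟨i, j, h, rfl⟩ := hr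
  · rw [map_mul, map_inv, mul_inv_eq_one, map_mul, map_mul, FreeGroup.lift_apply_of,
      FreeGroup.lift_apply_of]
    rcases h with h | h
    · exact sigmaEquiv_comm n q t _ _ _ _ (by omega)
    · exact (sigmaEquiv_comm n q t _ _ _ _ (by omega)).symm
  · rw [map_mul, map_inv, mul_inv_eq_one, map_mul, map_mul, map_mul, map_mul,
      FreeGroup.lift_apply_of, FreeGroup.lift_apply_of]
    exact sigmaEquiv_braid n q t _ _ _ _ (by omega)

/-- Krammer's representation `B_n → Aut(V)` for invertible elements `q, t` of a commutative ring
`R`: the homomorphism sending the generator `σ_k` to the automorphism given on the basis by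
`x_{i,j} ↦ σ_k(x_{i,j})`. -/
noncomputable def rep (n : ℕ) (q t : Rˣ) : BraidGroup n →* (V n R ≃ₗ[R] V n R) :=
  PresentedGroup.toGroup (sigmaEquiv_rels n q t)

/-- The generator `σ_{k+1}` acts on the basis vectors by the defining formula. -/
theorem rep_sigma_x (n : ℕ) (q t : Rˣ) (k : Fin (n - 1)) (i j : ℕ) (hi : 1 ≤ i) (hij : i < j)
    (hj : j ≤ n) :
    rep n q t (BraidGroup.sigma k) (x n R i j) = sigmaX n (q : R) (t : R) ((k : ℕ) + 1) i j := by
  rw [← sigmaLin_x n (q : R) (t : R) _ hi hij hj]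
  simp only [rep, BraidGroup.sigma, PresentedGroup.toGroup.of]
  rfl

end

/-! ### The two coefficient rings -/

/-- The variable of the Laurent polynomial ring `A[T^{±1}]`, as an invertible element. -/
noncomputable def laurentVar (A : Type*) [CommRing A] : (A[T;T⁻¹])ˣ where
  val := LaurentPolynomial.T 1
  inv := LaurentPolynomial.T (-1)
  val_inv := by rw [← LaurentPolynomial.T_add]; simp
  inv_val := by rw [← LaurentPolynomial.T_add]; simp

/-- An invertible element of `A`, as an invertible constant of `A[T^{±1}]`. -/
noncomputable def laurentConst {A : Type*} [CommRing A] (a : Aˣ) : (A[T;T⁻¹])ˣ :=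
  Units.map (LaurentPolynomial.C : A →+* A[T;T⁻¹]).toMonoidHom a

end Krammer

/-! Every braid is a fraction of positive braids (`exists_positive_fraction`), so it suffices to
separate positive braids. The matrices of the generators are polynomial in `t`, hence two positive
words acting equally over `ℝ[t^{±1}]` still act equally at `t = 0` (`wordAct_ones_eq`).

At `t = 0` with `0 < q < 1` all matrix entries are nonnegative, so there is no cancellation: the set
of vanishing coordinates of a nonnegative vector evolves by a purely combinatorial rule
(`zeros_sigmaLin`). Starting from the all-ones vector, this set stays closed under transitivity, and
its interior is the inversion set of a permutation (`Closed.biclosed_int`). The rule is compatible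
with interiors (`int_push_int`) and with left multiplication of permutation braids
(`Biclosed.exists_sg_mul_lift`). Hence the permutation braid of the interior divides the word on the
left (`exists_wordBraid_eq_lift_mul`). This divisor depends only on the action, and it is nontrivial
unless the word is empty (`int_push_simple`). Cancelling it and inducting on word length gives
`wordBraid_eq_of_rep_eq`.

The two-variable case follows by specializing `q` to `1/2`, since faithfulness after a base change
implies faithfulness before it. -/

namespace Krammer

/-! ### Closed and biclosed sets of pairs -/

/-- A transitive relation contained in `{(i, j) : 1 ≤ i < j ≤ n}`. -/
structure Closed (n : ℕ) (A : ℕ → ℕ → Prop) : Prop where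
  bound : ∀ {i j}, A i j → 1 ≤ i ∧ i < j ∧ j ≤ n
  trans : ∀ {i j k}, A i j → A j k → A i k

/-- A closed relation with transitive complement: the inversion set of a permutation. -/
structure Biclosed (n : ℕ) (B : ℕ → ℕ → Prop) : Prop extends Closed n B where
  cotrans : ∀ {i j k}, B i k → i < j → j < k → B i j ∨ B j k

/-- The transposition of `k` and `k + 1`. -/
def sw (k a : ℕ) : ℕ := if a = k then k + 1 else if a = k + 1 then k else a

/-- The inversion set of `s_k w`, where `B` is the inversion set of `w`, without `(k, k + 1)`. -/
def peel (k : ℕ) (B : ℕ → ℕ → Prop) (a b : ℕ) : Prop := a < b ∧ B (sw k a) (sw k b)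

/-- The effect of `σ_k` on the set of vanishing coordinates of a nonnegative vector at `t = 0`. -/
def push (k : ℕ) (A : ℕ → ℕ → Prop) (i j : ℕ) : Prop :=
  (i = k ∧ j = k + 1) ∨
  (i = k + 1 ∧ A k j ∧ A (k + 1) j) ∨
  (i = k ∧ k + 1 < j ∧ A (k + 1) j) ∨
  (j = k ∧ A i k ∧ A i (k + 1)) ∨
  (j = k + 1 ∧ i < k ∧ A i k) ∨
  (i ≠ k ∧ i ≠ k + 1 ∧ j ≠ k ∧ j ≠ k + 1 ∧ A i j)

/-- The interior of a relation: the complement of the transitive closure of the complement. -/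
def int (A : ℕ → ℕ → Prop) (i j : ℕ) : Prop :=
  i < j ∧ ¬ Relation.TransGen (fun a b => a < b ∧ ¬ A a b) i j

theorem position (k a : ℕ) : a < k ∨ a = k ∨ a = k + 1 ∨ k + 1 < a := by omega

theorem Closed.lt {n : ℕ} {A : ℕ → ℕ → Prop} (hA : Closed n A) {i j : ℕ} (h : A i j) : i < j :=
  (hA.bound h).2.1

theorem push_mono {k : ℕ} {A A' : ℕ → ℕ → Prop} (h : ∀ i j, A i j → A' i j) (i j : ℕ) :
    push k A i j → push k A' i j := by
  unfold push
  grind (splits := 20)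

theorem peel_mono {k : ℕ} {A A' : ℕ → ℕ → Prop} (h : ∀ i j, A i j → A' i j) (i j : ℕ) :
    peel k A i j → peel k A' i j := fun hA => ⟨hA.1, h _ _ hA.2⟩

theorem Closed.push {n k : ℕ} {A : ℕ → ℕ → Prop} (hA : Closed n A) (hk : 1 ≤ k)
    (hk' : k + 1 ≤ n) : Closed n (push k A) where
  bound := by
    intro i j h
    unfold Krammer.push at h
    rcases h with h | h | h | h | h | h
    · omega
    · have := hA.bound h.2.1
      have := hA.bound h.2.2
      omega
    · have := hA.bound h.2.2
      omega
    · have := hA.bound h.2.1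
      omega
    · have := hA.bound h.2.2
      omega
    · exact hA.bound h.2.2.2.2
  trans := by
    intro i j l
    have h1 := @hA.lt
    have h2 := @hA.trans
    unfold Krammer.push
    rcases position k i with hi | hi | hi | hi <;> rcases position k j with hj | hj | hj | hj <;>
      rcases position k l with hl | hl | hl | hl <;> grind (splits := 20)

theorem Biclosed.peel {n k : ℕ} {B : ℕ → ℕ → Prop} (hB : Biclosed n B) (h : B k (k + 1)) :
    Biclosed n (peel k B) where
  bound := by
    intro i j h
    unfold Krammer.peel sw at h
    have := @hB.bound
    grind
  trans := by
    intro i j l h h'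
    unfold Krammer.peel sw at h h' ⊢
    have := @hB.lt
    have := @hB.trans
    grind
  cotrans := by
    intro i j l h h1 h2
    unfold Krammer.peel at h ⊢
    -- `sw k` reverses the order of the pair `(k, k + 1)` only. If `(i, j)` or `(j, l)` is that
    -- pair, transitivity through `B k (k + 1)` replaces cotransitivity.
    by_cases c1 : sw k i < sw k j
    · by_cases c2 : sw k j < sw k l
      · have := hB.cotrans h.2 c1 c2
        grind
      · have e1 : j = k := by unfold sw at c2; grind
        have e2 : l = k + 1 := by unfold sw at c2; grind
        subst e1 e2
        have := @hB.trans
        have := @hB.bound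
        unfold sw at h ⊢
        grind
    · have e1 : i = k := by unfold sw at c1; grind
      have e2 : j = k + 1 := by unfold sw at c1; grind
      subst e1 e2
      have := @hB.trans
      have := @hB.bound
      unfold sw at h ⊢
      grind

/-- The conjunctions in `push` collapse by transitivity: given `B k (k + 1)`, the condition `B (k +
1) j` implies `B k j`, and `B i k` implies `B i (k + 1)`. -/
theorem push_peel {n k : ℕ} {B : ℕ → ℕ → Prop} (hB : Biclosed n B) (h : B k (k + 1)) :
    push k (peel k B) = B := by
  funext i j
  have h1 := @hB.lt
  have h2 := @hB.trans
  have h3 := @hB.cotrans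
  unfold push peel sw
  rcases position k i with hi | hi | hi | hi <;>
    rcases position k j with hj | hj | hj | hj <;> grind

theorem Biclosed.push {n k : ℕ} {B : ℕ → ℕ → Prop} (hB : Biclosed n B) (hk : 1 ≤ k)
    (hk' : k + 1 ≤ n) (h : ¬ B k (k + 1)) : Biclosed n (push k B) where
  toClosed := hB.toClosed.push hk hk'
  cotrans := by
    intro i j l
    have h1 := @hB.lt
    have h2 := @hB.trans
    have h3 := @hB.cotrans
    unfold Krammer.push
    rcases position k i with hi | hi | hi | hi <;> rcases position k j with hj | hj | hj | hj <;>
      rcases position k l with hl | hl | hl | hl <;> grind (splits := 20)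

/-- Here cotransitivity collapses the conjunctions: since `(k, k + 1)` is absent, `B k j` forces `B
(k + 1) j`, and `B i (k + 1)` forces `B i k`. -/
theorem peel_push {n k : ℕ} {B : ℕ → ℕ → Prop} (hB : Biclosed n B) (h : ¬ B k (k + 1)) :
    peel k (push k B) = B := by
  funext i j
  have h1 := @hB.lt
  have h2 := @hB.trans
  have h3 := @hB.cotrans
  unfold push peel sw
  rcases position k i with hi | hi | hi | hi <;>
    rcases position k j with hj | hj | hj | hj <;> grind

theorem push_simple (k : ℕ) (A : ℕ → ℕ → Prop) : push k A k (k + 1) := Or.inl ⟨rfl, rfl⟩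

/-- One half of an adjunction between `peel k` and `push k`. For biclosed sets containing `(k, k +
1)` the other half is `push_mono` with `push_peel`. -/
theorem peel_le_of_le_push {n k : ℕ} {A B : ℕ → ℕ → Prop} (hA : Closed n A)
    (hB : Closed n B) (h : ∀ i j, B i j → push k A i j) (i j : ℕ) : peel k B i j → A i j := by
  intro hp
  have h1 := @hA.bound
  have h2 := @hB.bound
  have h' := h _ _ hp.2
  have h3 := hp.1
  unfold sw push at h'
  rcases position k i with hi | hi | hi | hi <;>
    rcases position k j with hj | hj | hj | hj <;> grind

theorem Biclosed.exists_simple {n : ℕ} {B : ℕ → ℕ → Prop} (hB : Biclosed n B) {i j : ℕ}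
    (h : B i j) : ∃ k, B k (k + 1) := by
  obtain ⟨d, rfl⟩ : ∃ d, j = i + 1 + d := ⟨j - (i + 1), by have := hB.bound h; omega⟩
  induction d generalizing i with
  | zero => exact ⟨i, h⟩
  | succ d ih =>
    rcases hB.cotrans h (j := i + 1) (by omega) (by omega) with h' | h'
    · exact ⟨i, h'⟩
    · exact ih (i := i + 1) (by convert h' using 1; omega)

/-! ### Interiors of closed relations -/

theorem int_le {A : ℕ → ℕ → Prop} (i j : ℕ) (h : int A i j) : A i j := by
  by_contra hA
  exact h.2 (.single ⟨h.1, hA⟩)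

theorem int_mono {A A' : ℕ → ℕ → Prop} (h : ∀ i j, A i j → A' i j) (i j : ℕ)
    (hA : int A i j) : int A' i j :=
  ⟨hA.1, fun H => hA.2 (Relation.TransGen.mono
    (fun a b hab => ⟨hab.1, fun h' => hab.2 (h a b h')⟩) _ _ H)⟩

theorem transGen_lt {A : ℕ → ℕ → Prop} {i j : ℕ}
    (h : Relation.TransGen (fun a b => a < b ∧ ¬ A a b) i j) : i < j := by
  induction h with
  | single h => exact h.1
  | tail _ h ih => exact ih.trans h.1

/-- An increasing path from `i` to `k` either visits `j` or jumps over it in a single step `(a, b)`.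
-/
theorem transGen_split {A : ℕ → ℕ → Prop} {i j k : ℕ}
    (h : Relation.TransGen (fun a b => a < b ∧ ¬ A a b) i k) (hij : i < j) (hjk : j < k) :
    (Relation.TransGen (fun a b => a < b ∧ ¬ A a b) i j ∧
      Relation.TransGen (fun a b => a < b ∧ ¬ A a b) j k) ∨
    ∃ a b, a < j ∧ j < b ∧ ¬ A a b ∧
      Relation.ReflTransGen (fun a b => a < b ∧ ¬ A a b) i a ∧
      Relation.ReflTransGen (fun a b => a < b ∧ ¬ A a b) b k := by
  induction h with
  | single h => exact Or.inr ⟨_, _, hij, hjk, h.2, .refl, .refl⟩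
  | @tail b c hb hc ih =>
    rcases lt_trichotomy j b with hlt | rfl | hlt
    · rcases ih hlt with ⟨h1, h2⟩ | ⟨a, a', h1, h2, h3, h4, h5⟩
      · exact Or.inl ⟨h1, h2.tail hc⟩
      · exact Or.inr ⟨a, a', h1, h2, h3, h4, h5.tail hc⟩
    · exact Or.inl ⟨hb, .single hc⟩
    · exact Or.inr ⟨b, c, hlt, hjk, hc.2, hb.to_reflTransGen, .refl⟩

/-- For transitivity, take a path in the complement from `i` to `k`. If it jumps over `j` by a step
`(a, b)` outside `A`, closedness puts `(a, j)` or `(j, b)` outside `A`, and rerouting through `j`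
gives a complement path from `i` to `j` or from `j` to `k`. -/
theorem Closed.biclosed_int {n : ℕ} {A : ℕ → ℕ → Prop} (hA : Closed n A) :
    Biclosed n (int A) where
  bound := fun h => hA.bound (int_le _ _ h)
  trans := by
    intro i j k h h'
    refine ⟨h.1.trans h'.1, fun H => ?_⟩
    rcases transGen_split H h.1 h'.1 with ⟨h1, -⟩ | ⟨a, b, haj, hjb, hab, h1, h2⟩
    · exact h.2 h1
    · refine hab (hA.trans (j := j) ?_ ?_)
      · by_contra hc
        exact h.2 (Relation.TransGen.tail' h1 ⟨haj, hc⟩)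
      · by_contra hc
        exact h'.2 (Relation.TransGen.head' ⟨hjb, hc⟩ h2)
  cotrans := by
    intro i j k h h1 h2
    by_contra! H
    unfold int at H h
    have H1 := not_not.1 fun h3 => H.1 ⟨h1, h3⟩
    have H2 := not_not.1 fun h3 => H.2 ⟨h2, h3⟩
    exact h.2 (H1.trans H2)

theorem Biclosed.int_eq {n : ℕ} {B : ℕ → ℕ → Prop} (hB : Biclosed n B) : int B = B := by
  funext i j
  refine propext ⟨int_le i j, fun h => ⟨(hB.bound h).2.1, fun H => ?_⟩⟩
  induction H with
  | single h' => exact h'.2 h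
  | @tail b c hb hc ih =>
    rcases hB.cotrans h (transGen_lt hb) hc.1 with h' | h'
    · exact ih h'
    · exact hc.2 h'

/-- An increasing path from `k` to `k + 1` is a single step, and that step is not in the complement.
This is why a nonempty word has a nontrivial simple divisor. -/
theorem int_push_simple (k : ℕ) (A : ℕ → ℕ → Prop) : int (push k A) k (k + 1) := by
  refine ⟨k.lt_succ_self, fun H => ?_⟩
  obtain ⟨b, hb, hc⟩ := Relation.TransGen.tail'_iff.1 H
  rcases Relation.reflTransGen_iff_eq_or_transGen.1 hb with rfl | hb
  · exact hc.2 (push_simple _ A)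
  · have := transGen_lt hb
    have := hc.1
    omega

/-- Only the interior of the vanishing set matters for later steps. The interior of `push k A`
contains `(k, k + 1)`; its peel is biclosed and lies in `A`, hence in `int A`, and pushing back
gives the nontrivial inclusion. -/
theorem int_push_int {n k : ℕ} {A : ℕ → ℕ → Prop} (hA : Closed n A) (hk : 1 ≤ k)
    (hk' : k + 1 ≤ n) : int (push k (int A)) = int (push k A) := by
  funext i j
  refine propext ⟨int_mono (push_mono int_le) i j, fun h => ?_⟩
  have hB := (hA.push hk hk').biclosed_int
  have hs := int_push_simple k A
  have hp := hB.peel hs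
  have h1 : ∀ i j, peel k (int (push k A)) i j → int A i j := by
    intro i j h
    rw [← hp.int_eq] at h
    exact int_mono (peel_le_of_le_push hA hB.toClosed int_le) i j h
  have h2 := push_mono (k := k) h1
  rw [push_peel hB hs] at h2
  rw [← hB.int_eq] at h
  exact int_mono h2 i j h

/-! ### Simple braids -/

/-- The generator `σ_k` for `1 ≤ k < n`, and `1` for other `k`. -/
def sg (n k : ℕ) : BraidGroup n :=
  if h : 1 ≤ k ∧ k + 1 ≤ n then BraidGroup.sigma ⟨k - 1, by omega⟩ else 1

theorem sg_succ {n : ℕ} (k : Fin (n - 1)) : sg n (k + 1) = BraidGroup.sigma k := by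
  rw [sg, dif_pos (by omega)]
  rfl

theorem sg_comm {n k l : ℕ} (hk : 1 ≤ k) (hkl : k + 2 ≤ l) (hl : l + 1 ≤ n) :
    sg n k * sg n l = sg n l * sg n k := by
  rw [sg, sg, dif_pos (by omega), dif_pos (by omega), ← mul_inv_eq_one]
  exact PresentedGroup.one_of_mem (rels := braidRels n)
    (Or.inl ⟨⟨k - 1, by omega⟩, ⟨l - 1, by omega⟩, Or.inl (by simp only; omega), rfl⟩)

theorem sg_braid {n k : ℕ} (hk : 1 ≤ k) (hl : k + 2 ≤ n) :
    sg n k * sg n (k + 1) * sg n k = sg n (k + 1) * sg n k * sg n (k + 1) := by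
  rw [sg, sg, dif_pos (by omega), dif_pos (by omega), ← mul_inv_eq_one]
  exact PresentedGroup.one_of_mem (rels := braidRels n)
    (Or.inr ⟨⟨k - 1, by omega⟩, ⟨k + 1 - 1, by omega⟩, by simp only; omega, rfl⟩)

/-- The number of pairs in a relation. -/
noncomputable def size (B : ℕ → ℕ → Prop) : ℕ := {p : ℕ × ℕ | B p.1 p.2}.ncard

theorem Closed.finite {n : ℕ} {A : ℕ → ℕ → Prop} (hA : Closed n A) :
    {p : ℕ × ℕ | A p.1 p.2}.Finite :=
  (Set.finite_Icc (0, 0) (n, n)).subset fun p hp => by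
    have := hA.bound hp
    exact ⟨⟨Nat.zero_le _, Nat.zero_le _⟩, ⟨by omega, by omega⟩⟩

theorem sw_sw (k a : ℕ) : sw k (sw k a) = a := by
  unfold sw
  grind

theorem Biclosed.size_peel {n k : ℕ} {B : ℕ → ℕ → Prop} (hB : Biclosed n B) (h : B k (k + 1)) :
    size (Krammer.peel k B) + 1 = size B := by
  have hf := hB.finite
  have hm : ((k, k + 1) : ℕ × ℕ) ∈ {p : ℕ × ℕ | B p.1 p.2} := h
  unfold size
  rw [← Set.ncard_sdiff_singleton_add_one hm hf]
  congr 1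
  refine Set.ncard_congr (fun p _ => (sw k p.1, sw k p.2)) ?_ ?_ ?_
  · rintro ⟨a, b⟩ ⟨h1, h2⟩
    refine ⟨h2, fun he => ?_⟩
    have e1 := sw_sw k a
    have e2 := sw_sw k b
    simp only [Set.mem_singleton_iff, Prod.mk.injEq] at he
    rw [he.1] at e1
    rw [he.2] at e2
    simp only [sw] at e1 e2 h1
    grind
  · rintro ⟨a, b⟩ ⟨c, d⟩ _ _ he
    simp only [Prod.mk.injEq] at he
    rw [← sw_sw k a, ← sw_sw k b, he.1, he.2, sw_sw, sw_sw]
  · rintro ⟨a, b⟩ ⟨h1, h2⟩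
    refine ⟨(sw k a, sw k b), ⟨?_, ?_⟩, ?_⟩
    · have := hB.lt h1
      simp only [Set.mem_singleton_iff, Prod.mk.injEq] at h2
      simp only [sw]
      grind
    · simpa only [sw_sw, Set.mem_ofPred_eq] using h1
    · simp only [sw_sw]

open Classical in
/-- A product of at most `m` generators obtained by peeling simple reflections off `B`. -/
noncomputable def liftAux (n : ℕ) : ℕ → (ℕ → ℕ → Prop) → BraidGroup n
  | 0, _ => 1
  | m + 1, B => if h : ∃ k, B k (k + 1) then sg n h.choose * liftAux n m (peel h.choose B) else 1

/-- The positive permutation braid with inversion set `B`. -/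
noncomputable def lift (n : ℕ) (B : ℕ → ℕ → Prop) : BraidGroup n := liftAux n (size B) B

theorem lift_of_forall_not (n : ℕ) {B : ℕ → ℕ → Prop} (h : ∀ i j, ¬ B i j) : lift n B = 1 := by
  have : size B = 0 := by
    have : {p : ℕ × ℕ | B p.1 p.2} = ∅ := Set.eq_empty_of_forall_notMem fun p hp => h _ _ hp
    rw [size, this, Set.ncard_empty]
  rw [lift, this, liftAux]

theorem Biclosed.exists_lift_eq {n k : ℕ} {B : ℕ → ℕ → Prop} (hB : Biclosed n B)
    (h : B k (k + 1)) : ∃ l, B l (l + 1) ∧ lift n B = sg n l * lift n (Krammer.peel l B) := by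
  have hex : ∃ l, B l (l + 1) := ⟨k, h⟩
  refine ⟨hex.choose, hex.choose_spec, ?_⟩
  unfold lift
  rw [← hB.size_peel hex.choose_spec, liftAux, dif_pos hex]

/-! ### Independence of the order of peeling -/

theorem peel_peel_le {n k l : ℕ} {B : ℕ → ℕ → Prop} (hB : Biclosed n B)
    (hkl : k + 2 ≤ l ∨ l + 2 ≤ k) (i j : ℕ) (h : peel k (peel l B) i j) :
    peel l (peel k B) i j := by
  obtain ⟨h1, h2, h3⟩ := h
  have hc : ∀ a, sw l (sw k a) = sw k (sw l a) := fun a => by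
    unfold sw
    grind
  rw [hc, hc] at h3
  refine ⟨h1, ?_, h3⟩
  by_contra h4
  have e : i = l ∧ j = l + 1 := by
    unfold sw at h4
    grind
  obtain ⟨rfl, rfl⟩ := e
  have h5 := hB.lt h3
  unfold sw at h5
  grind

theorem peel_comm {n k l : ℕ} {B : ℕ → ℕ → Prop} (hB : Biclosed n B) (hkl : k + 2 ≤ l) :
    peel k (peel l B) = peel l (peel k B) := by
  funext i j
  exact propext ⟨peel_peel_le hB (Or.inl hkl) i j, peel_peel_le hB (Or.inr hkl) i j⟩

theorem sw_spec (k a : ℕ) : a = k ∧ sw k a = k + 1 ∨ a = k + 1 ∧ sw k a = k ∨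
    a ≠ k ∧ a ≠ k + 1 ∧ sw k a = a := by
  unfold sw
  grind

theorem sw_braid (k a : ℕ) : sw k (sw (k + 1) (sw k a)) = sw (k + 1) (sw k (sw (k + 1) a)) := by
  unfold sw
  grind

/-- The intermediate order conditions are redundant: along a reduced word of length three in two
adjacent transpositions, a pair once inverted stays inverted. The right-hand side is then symmetric
in `k` and `l` by `sw_braid`. -/
theorem peel_peel_peel {n k l : ℕ} {B : ℕ → ℕ → Prop} (hB : Biclosed n B)
    (hkl : l = k + 1 ∨ k = l + 1) :
    peel k (peel l (peel k B)) =
      fun i j => i < j ∧ B (sw k (sw l (sw k i))) (sw k (sw l (sw k j))) := by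
  funext i j
  refine propext ⟨fun h => ⟨h.1, h.2.2.2⟩, fun h => ?_⟩
  have h1 := hB.lt h.2
  have h0 := h.1
  suffices h3 : sw k i < sw k j ∧ sw l (sw k i) < sw l (sw k j) from ⟨h0, h3.1, h3.2, h.2⟩
  have i1 := sw_spec k i
  have i2 := sw_spec l (sw k i)
  have i3 := sw_spec k (sw l (sw k i))
  have j1 := sw_spec k j
  have j2 := sw_spec l (sw k j)
  have j3 := sw_spec k (sw l (sw k j))
  clear h hB
  generalize sw k (sw l (sw k i)) = a3 at *
  generalize sw k (sw l (sw k j)) = b3 at *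
  generalize sw l (sw k i) = a2 at *
  generalize sw l (sw k j) = b2 at *
  generalize sw k i = a1 at *
  generalize sw k j = b1 at *
  rcases i1 with i1 | i1 | i1 <;> rcases j1 with j1 | j1 | j1 <;> omega

theorem peel_braid {n k : ℕ} {B : ℕ → ℕ → Prop} (hB : Biclosed n B) :
    peel k (peel (k + 1) (peel k B)) = peel (k + 1) (peel k (peel (k + 1) B)) := by
  rw [peel_peel_peel hB (Or.inl rfl), peel_peel_peel hB (Or.inr rfl)]
  simp only [sw_braid]

/-- Both sides are peeled further until they meet: after one more letter if `k` and `l` are far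
apart, after two more if adjacent. The commutation or braid relation then identifies the prefixes.
-/
theorem Biclosed.sg_mul_lift_peel {n m : ℕ}
    (ih : ∀ B, Biclosed n B → size B < m → ∀ k, B k (k + 1) →
      lift n B = sg n k * lift n (Krammer.peel k B))
    {B : ℕ → ℕ → Prop} (hB : Biclosed n B) (hm : size B = m) {k l : ℕ} (hkl : k < l)
    (hk : B k (k + 1)) (hl : B l (l + 1)) :
    sg n k * lift n (Krammer.peel k B) = sg n l * lift n (Krammer.peel l B) := by
  have bk := hB.bound hk
  have bl := hB.bound hl
  have sk := hB.size_peel hk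
  have sl := hB.size_peel hl
  have pk := hB.peel hk
  have pl := hB.peel hl
  rcases Nat.lt_or_ge (k + 1) l with h2 | h2
  · have h1 : Krammer.peel k B l (l + 1) := by
      unfold Krammer.peel sw
      grind
    have h3 : Krammer.peel l B k (k + 1) := by
      unfold Krammer.peel sw
      grind
    rw [ih _ pk (by omega) l h1, ih _ pl (by omega) k h3, peel_comm hB h2, ← mul_assoc,
      ← mul_assoc, sg_comm bk.1 h2 bl.2.2]
  · obtain rfl : l = k + 1 := by omega
    have h3 := hB.trans hk hl
    have a1 : Krammer.peel k B (k + 1) (k + 1 + 1) := by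
      unfold Krammer.peel sw
      grind
    have a2 : Krammer.peel (k + 1) B k (k + 1) := by
      unfold Krammer.peel sw
      grind
    have b1 : Krammer.peel (k + 1) (Krammer.peel k B) k (k + 1) := by
      unfold Krammer.peel sw
      grind
    have b2 : Krammer.peel k (Krammer.peel (k + 1) B) (k + 1) (k + 1 + 1) := by
      unfold Krammer.peel sw
      grind
    have t1 := pk.size_peel a1
    have t2 := pl.size_peel a2
    rw [ih _ pk (by omega) _ a1, ih _ pl (by omega) _ a2, ih _ (pk.peel a1) (by omega) _ b1,
      ih _ (pl.peel a2) (by omega) _ b2, peel_braid hB]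
    simp only [← mul_assoc]
    rw [sg_braid bk.1 bl.2.2]

/-- The arbitrary choices in `liftAux` are immaterial: any descent may serve as first letter, an
instance of Matsumoto's theorem. -/
theorem Biclosed.lift_eq {n : ℕ} {B : ℕ → ℕ → Prop} (hB : Biclosed n B) {k : ℕ}
    (h : B k (k + 1)) : lift n B = sg n k * lift n (Krammer.peel k B) := by
  induction hm : size B using Nat.strong_induction_on generalizing B k with
  | _ m ih =>
    have ih' : ∀ B, Biclosed n B → size B < m → ∀ k, B k (k + 1) →
        lift n B = sg n k * lift n (Krammer.peel k B) :=
      fun B hB hs k hk => ih _ hs hB hk rfl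
    obtain ⟨l, hl, he⟩ := hB.exists_lift_eq h
    rw [he]
    rcases lt_trichotomy k l with hkl | rfl | hkl
    · exact (hB.sg_mul_lift_peel ih' hm hkl h hl).symm
    · rfl
    · exact hB.sg_mul_lift_peel ih' hm hkl hl h

/-! ### Positive braids -/

/-- The submonoid of positive braids. -/
def positive (n : ℕ) : Submonoid (BraidGroup n) := Submonoid.closure (Set.range (sg n))

theorem sg_mem_positive (n k : ℕ) : sg n k ∈ positive n := Submonoid.subset_closure ⟨k, rfl⟩

/-- Inclusion of inversion sets gives left divisibility, because a simple pair of the smaller set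
can be peeled off both. -/
theorem Biclosed.lift_dvd_lift {n : ℕ} {B B' : ℕ → ℕ → Prop} (hB : Biclosed n B)
    (hB' : Biclosed n B') (h : ∀ i j, B i j → B' i j) :
    ∃ p ∈ positive n, lift n B' = lift n B * p := by
  induction hm : size B' using Nat.strong_induction_on generalizing B B' with
  | _ m ih =>
    by_cases he : ∃ i j, B i j
    · obtain ⟨i, j, hij⟩ := he
      obtain ⟨k, hk⟩ := hB.exists_simple hij
      have hk' := h _ _ hk
      have := hB'.size_peel hk'
      obtain ⟨p, hp, e⟩ := ih _ (by omega) (hB.peel hk) (hB'.peel hk') (peel_mono h) rfl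
      exact ⟨p, hp, by rw [hB'.lift_eq hk', hB.lift_eq hk, e, mul_assoc]⟩
    · push Not at he
      rw [lift_of_forall_not n he]
      refine ⟨_, ?_, (one_mul _).symm⟩
      -- With `B` empty the claim is positivity of `lift n B'`, so letters are peeled from `B'`
      -- alone.
      by_cases he' : ∃ i j, B' i j
      · obtain ⟨i, j, hij⟩ := he'
        obtain ⟨k, hk⟩ := hB'.exists_simple hij
        have := hB'.size_peel hk
        obtain ⟨p, hp, e⟩ := ih _ (by omega) hB (hB'.peel hk) (fun i j h => absurd h (he i j)) rfl
        rw [lift_of_forall_not n he, one_mul] at e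
        rw [hB'.lift_eq hk, e]
        exact mul_mem (sg_mem_positive n k) hp
      · push Not at he'
        rw [lift_of_forall_not n he']
        exact one_mem _

theorem biclosed_empty (n : ℕ) : Biclosed n fun _ _ => False where
  bound := False.elim
  trans h := h.elim
  cotrans h := h.elim

theorem Biclosed.lift_mem_positive {n : ℕ} {B : ℕ → ℕ → Prop} (hB : Biclosed n B) :
    lift n B ∈ positive n := by
  obtain ⟨p, hp, e⟩ := (biclosed_empty n).lift_dvd_lift hB (fun _ _ h => h.elim)
  rwa [e, lift_of_forall_not n (fun _ _ h => h), one_mul]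

theorem Biclosed.exists_sg_mul_lift {n k : ℕ} {B : ℕ → ℕ → Prop} (hB : Biclosed n B)
    (hk : 1 ≤ k) (hk' : k + 1 ≤ n) :
    ∃ p ∈ positive n, sg n k * lift n B = lift n (int (Krammer.push k B)) * p := by
  -- If `(k, k + 1)` is in `B`, the peeled interior is contained in `B` and divisibility supplies
  -- `p`. Otherwise `push k B` is already biclosed and `p = 1`.
  by_cases h : B k (k + 1)
  · have hI := (hB.toClosed.push hk hk').biclosed_int
    have hs := int_push_simple k B
    obtain ⟨p, hp, e⟩ := (hI.peel hs).lift_dvd_lift hB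
      (peel_le_of_le_push hB.toClosed hI.toClosed int_le)
    exact ⟨p, hp, by rw [e, hI.lift_eq hs, mul_assoc]⟩
  · have hp := hB.push hk hk' h
    refine ⟨1, one_mem _, ?_⟩
    rw [hp.int_eq, hp.lift_eq (push_simple k B), peel_push hB h, mul_one]

/-! ### Fractions of positive braids -/

/-- The set of all pairs, that is, the inversion set of the longest permutation. -/
def full (n i j : ℕ) : Prop := 1 ≤ i ∧ i < j ∧ j ≤ n

theorem biclosed_full (n : ℕ) : Biclosed n (full n) where
  bound := id
  trans h h' := ⟨h.1, h.2.1.trans h'.2.1, h'.2.2⟩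
  cotrans h h1 h2 := Or.inl ⟨h.1, h1, (h2.trans_le h.2.2).le⟩

theorem push_full {n k : ℕ} (hk : 1 ≤ k) (hk' : k + 1 ≤ n) : push k (full n) = full n := by
  funext i j
  unfold push full
  grind (splits := 20)

/-- The full set is fixed by `push k`, so `exists_sg_mul_lift` lets each generator pass through the
half twist, leaving a positive braid on the other side. -/
theorem inv_mul_mul_mem_positive {n : ℕ} {p : BraidGroup n} (hp : p ∈ positive n) :
    (lift n (full n))⁻¹ * p * lift n (full n) ∈ positive n := by
  induction hp using Submonoid.closure_induction with
  | mem x hx =>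
    obtain ⟨k, rfl⟩ := hx
    by_cases h : 1 ≤ k ∧ k + 1 ≤ n
    · obtain ⟨p, hp, e⟩ := (biclosed_full n).exists_sg_mul_lift h.1 h.2
      rw [push_full h.1 h.2, (biclosed_full n).int_eq] at e
      rwa [mul_assoc, e, inv_mul_cancel_left]
    · rw [sg, dif_neg h, mul_one, inv_mul_cancel]
      exact one_mem _
  | one =>
    rw [mul_one, inv_mul_cancel]
    exact one_mem _
  | mul x y _ _ hx hy =>
    convert mul_mem hx hy using 1
    group

theorem exists_mul_pow_mem_positive {n : ℕ} (g : BraidGroup n) :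
    ∃ m, g * lift n (full n) ^ m ∈ positive n := by
  have hg : g ∈ Subgroup.closure (Set.range (PresentedGroup.of (rels := braidRels n))) := by
    rw [PresentedGroup.closure_range_of]
    trivial
  induction hg using Subgroup.closure_induction_left with
  | one => exact ⟨0, by rw [pow_zero, mul_one]; exact one_mem _⟩
  | mul_left x hx y _ hy =>
    obtain ⟨k, rfl⟩ := hx
    obtain ⟨m, hm⟩ := hy
    refine ⟨m, ?_⟩
    rw [mul_assoc]
    have := sg_mem_positive n (k + 1)
    rw [sg_succ] at this
    exact mul_mem this hm
  | inv_mul_cancel x hx y _ hy =>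
    obtain ⟨k, rfl⟩ := hx
    obtain ⟨m, hm⟩ := hy
    refine ⟨m + 1, ?_⟩
    have hk : full n (k + 1) (k + 1 + 1) := ⟨by omega, by omega, by omega⟩
    have e := (biclosed_full n).lift_eq hk
    rw [sg_succ] at e
    have hpeel := ((biclosed_full n).peel hk).lift_mem_positive
    -- With `Δ` the half twist, `σ⁻¹ y Δ^(m+1) = (σ⁻¹ Δ) (Δ⁻¹ (y Δ^m) Δ)`, and `σ⁻¹ Δ` is the lift
    -- of the peeled full set.
    convert mul_mem hpeel (inv_mul_mul_mem_positive hm) using 1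
    rw [pow_succ, eq_inv_mul_of_mul_eq e.symm]
    change (BraidGroup.sigma k)⁻¹ * y * _ = _
    group

theorem exists_positive_fraction {n : ℕ} (g : BraidGroup n) :
    ∃ x ∈ positive n, ∃ y ∈ positive n, g = x * y⁻¹ := by
  obtain ⟨m, hm⟩ := exists_mul_pow_mem_positive g
  exact ⟨_, hm, _, pow_mem (biclosed_full n).lift_mem_positive m, (mul_inv_cancel_right _ _).symm⟩

/-! ### Base change -/

section BaseChange

variable {R R' : Type*} [CommRing R] [CommRing R'] (n : ℕ) (φ : R →+* R')

/-- The map `V n R → V n R'` applying a ring homomorphism to all coordinates. -/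
noncomputable def mapV : V n R →+ V n R' := Finsupp.mapRange.addMonoidHom φ.toAddMonoidHom

theorem mapV_apply (v : V n R) (s : Ref n) : mapV n φ v s = φ (v s) := rfl

theorem mapV_smul (r : R) (v : V n R) : mapV n φ (r • v) = φ r • mapV n φ v := by
  ext s
  simp [mapV_apply]

theorem mapV_x (i j : ℕ) : mapV n φ (x n R i j) = x n R' i j := by
  unfold x
  split_ifs
  · simp [mapV]
  · exact map_zero _

theorem mapV_sigmaX (q t : R) (k i j : ℕ) :
    mapV n φ (sigmaX n q t k i j) = sigmaX n (φ q) (φ t) k i j := by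
  unfold sigmaX
  split_ifs <;> simp only [map_add, mapV_smul, mapV_x, map_sub, map_mul, map_pow, map_one]

theorem mapV_sigmaLin (q t : R) (k : ℕ) (v : V n R) :
    mapV n φ (sigmaLin n q t k v) = sigmaLin n (φ q) (φ t) k (mapV n φ v) := by
  induction v using Finsupp.induction_linear with
  | zero => simp only [map_zero]
  | add v w hv hw => simp only [map_add, hv, hw]
  | single s r =>
    have h : mapV n φ (Finsupp.single s r) = Finsupp.single s (φ r) := by simp [mapV]
    rw [h]
    simp only [sigmaLin, Finsupp.linearCombination_single, mapV_smul, mapV_sigmaX]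

theorem rep_sigma_apply (q t : Rˣ) (k : Fin (n - 1)) (v : V n R) :
    rep n q t (BraidGroup.sigma k) v = sigmaLin n (q : R) (t : R) (k + 1) v := by
  simp only [rep, BraidGroup.sigma, PresentedGroup.toGroup.of]
  rfl

theorem rep_apply_rep_inv (q t : Rˣ) (g : BraidGroup n) (v : V n R) :
    rep n q t g (rep n q t g⁻¹ v) = v := by
  rw [← LinearEquiv.mul_apply, ← map_mul, mul_inv_cancel, map_one, LinearEquiv.coe_one, id]

theorem mapV_rep (q t : Rˣ) (g : BraidGroup n) (v : V n R) :
    mapV n φ (rep n q t g v) = rep n (Units.map φ.toMonoidHom q) (Units.map φ.toMonoidHom t) g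
      (mapV n φ v) := by
  have hg : g ∈ Subgroup.closure (Set.range (PresentedGroup.of (rels := braidRels n))) := by
    rw [PresentedGroup.closure_range_of]
    trivial
  induction hg using Subgroup.closure_induction generalizing v with
  | mem g hg =>
    obtain ⟨k, rfl⟩ := hg
    change mapV n φ (rep n q t (BraidGroup.sigma k) v) =
      rep n _ _ (BraidGroup.sigma k) (mapV n φ v)
    rw [rep_sigma_apply, rep_sigma_apply, mapV_sigmaLin]
    rfl
  | one => simp only [map_one, LinearEquiv.coe_one, id]
  | mul g h _ _ hg hh => simp only [map_mul, LinearEquiv.mul_apply, hg, hh]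
  | inv g _ hg =>
    apply (rep n (Units.map φ.toMonoidHom q) (Units.map φ.toMonoidHom t) g).injective
    exact (hg _).symm.trans ((congrArg _ (rep_apply_rep_inv n q t g v)).trans
      (rep_apply_rep_inv n _ _ g _).symm)

/-- A braid acting trivially over `R` fixes every basis vector, hence also over `R'`. The map `φ`
need not be injective. -/
theorem rep_injective_of_map (q t : Rˣ)
    (h : Function.Injective (rep n (Units.map φ.toMonoidHom q) (Units.map φ.toMonoidHom t))) :
    Function.Injective (rep n q t) := by
  rw [injective_iff_map_eq_one] at h ⊢
  intro g hg
  refine h g (LinearEquiv.toLinearMap_injective (hom_ext_x n fun i j _ _ _ => ?_))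
  have := mapV_rep n φ q t g (x n R i j)
  rw [hg, LinearEquiv.coe_one, id, mapV_x] at this
  exact this.symm

end BaseChange

/-! ### Positive words -/

section Words

variable {R R' : Type*} [CommRing R] [CommRing R'] {n : ℕ}

/-- The braid represented by a positive word. -/
def wordBraid (L : List (Fin (n - 1))) : BraidGroup n := (L.map BraidGroup.sigma).prod

/-- The action of a positive word on `V`, for `q` and `t` not necessarily invertible. -/
noncomputable def wordAct (q t : R) : List (Fin (n - 1)) → V n R → V n R
  | [], v => v
  | k :: L, v => sigmaLin n q t (k + 1) (wordAct q t L v)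

theorem wordBraid_cons (k : Fin (n - 1)) (L : List (Fin (n - 1))) :
    wordBraid (k :: L) = sg n (k + 1) * wordBraid L := by
  simp [wordBraid, sg_succ]

theorem wordBraid_append (L L' : List (Fin (n - 1))) :
    wordBraid (L ++ L') = wordBraid L * wordBraid L' := by
  simp [wordBraid]

theorem rep_wordBraid (q t : Rˣ) (L : List (Fin (n - 1))) (v : V n R) :
    rep n q t (wordBraid L) v = wordAct (q : R) (t : R) L v := by
  induction L with
  | nil => simp [wordBraid, wordAct]
  | cons k L ih =>
    rw [wordBraid_cons, map_mul, LinearEquiv.mul_apply, ih, sg_succ, rep_sigma_apply, wordAct]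

theorem mapV_wordAct (φ : R →+* R') (q t : R) (L : List (Fin (n - 1))) (v : V n R) :
    mapV n φ (wordAct q t L v) = wordAct (φ q) (φ t) L (mapV n φ v) := by
  induction L with
  | nil => rfl
  | cons k L ih => rw [wordAct, mapV_sigmaLin, ih, wordAct]

theorem exists_wordBraid {p : BraidGroup n} (hp : p ∈ positive n) : ∃ L, p = wordBraid L := by
  induction hp using Submonoid.closure_induction with
  | mem p hp =>
    obtain ⟨k, rfl⟩ := hp
    unfold sg
    split_ifs
    · exact ⟨[_], (List.prod_singleton).symm⟩
    · exact ⟨[], rfl⟩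
  | one => exact ⟨[], rfl⟩
  | mul p p' _ _ h h' =>
    obtain ⟨L, rfl⟩ := h
    obtain ⟨L', rfl⟩ := h'
    exact ⟨L ++ L', (wordBraid_append L L').symm⟩

/-- The homomorphism to `ℤ` sending every generator to `1`. -/
def exponentSum (n : ℕ) : BraidGroup n →* Multiplicative ℤ :=
  PresentedGroup.toGroup (f := fun _ => Multiplicative.ofAdd 1) (by
    rintro r (⟨i, j, -, rfl⟩ | ⟨i, j, -, rfl⟩) <;> simp)

theorem exponentSum_wordBraid (L : List (Fin (n - 1))) :
    exponentSum n (wordBraid L) = Multiplicative.ofAdd (L.length : ℤ) := by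
  induction L with
  | nil => rfl
  | cons k L ih =>
    rw [wordBraid_cons, map_mul, ih, sg_succ, exponentSum, BraidGroup.sigma,
      PresentedGroup.toGroup.of, ← ofAdd_add, List.length_cons]
    push_cast
    rw [add_comm]

/-- Splitting off a nontrivial positive divisor therefore shortens any representing word, which
drives the induction in `wordBraid_eq_of_rep_eq`. -/
theorem length_eq_of_wordBraid_eq {L L' : List (Fin (n - 1))} (h : wordBraid L = wordBraid L') :
    L.length = L'.length := by
  have := congrArg (exponentSum n) h
  rw [exponentSum_wordBraid, exponentSum_wordBraid] at this
  exact_mod_cast Multiplicative.ofAdd.injective this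

end Words

/-! ### Coordinates at `t = 0` -/

section Coordinates

variable {R : Type*} [CommRing R]

open Classical in
/-- The coordinate of a vector at `x_{i,j}`, and `0` if `(i, j)` is out of range. -/
noncomputable def coord (n i j : ℕ) : V n R →ₗ[R] R :=
  if h : full n i j then Finsupp.lapply ⟨(i, j), h⟩ else 0

theorem coord_x {n i j a b : ℕ} (h : full n i j) :
    coord n i j (x n R a b) = if a = i ∧ b = j then 1 else 0 := by
  unfold coord x
  rw [dif_pos h]
  unfold full at h
  split_ifs with h1 h2 h2
  · simp [h2.1, h2.2]
  · simp only [Finsupp.lapply_apply]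
    rw [Finsupp.single_eq_of_ne]
    rintro he
    simp only [Subtype.mk.injEq, Prod.mk.injEq] at he
    exact h2 ⟨he.1.symm, he.2.symm⟩
  · exact absurd (by rw [h2.1, h2.2]; exact h) h1
  · exact map_zero _

theorem sigmaX_zero (n : ℕ) (q : R) (k i j : ℕ) : sigmaX n q 0 k i j =
    if k + 1 < i ∨ j < k then x n R i j
    else if k + 1 = i then x n R (i - 1) j + (1 - q) • x n R i j
    else if k = i ∧ k + 1 < j then q • x n R (i + 1) j
    else if k = i ∧ k + 1 = j then 0
    else if i < k ∧ k + 1 < j then x n R i j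
    else if k + 1 = j then x n R i (j - 1)
    else (1 - q) • x n R i j + q • x n R i (j + 1) := by
  unfold sigmaX
  split_ifs <;> simp

/-- The rows of the matrix of `σ_k` at `t = 0`. Their entries `0`, `1`, `q`, `1 - q` are nonnegative
for `0 ≤ q ≤ 1`. -/
theorem coord_sigmaLin {n k : ℕ} (hk : 1 ≤ k) (hk' : k + 1 ≤ n) (q : R) {i j : ℕ}
    (h : full n i j) (v : V n R) :
    coord n i j (sigmaLin n q 0 k v) =
      if i = k ∧ j = k + 1 then 0
      else if i = k + 1 then (1 - q) * coord n (k + 1) j v + q * coord n k j v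
      else if i = k then coord n (k + 1) j v
      else if j = k then (1 - q) * coord n i k v + coord n i (k + 1) v
      else if j = k + 1 then q * coord n i k v
      else coord n i j v := by
  have key : ∀ f : V n R →ₗ[R] R, (∀ a b, 1 ≤ a → a < b → b ≤ n →
      coord n i j (sigmaX n q 0 k a b) = f (x n R a b)) →
      coord n i j (sigmaLin n q 0 k v) = f v := fun f hf => by
    suffices e : coord n i j ∘ₗ sigmaLin n q 0 k = f from LinearMap.congr_fun e v
    refine Finsupp.lhom_ext' fun ⟨⟨a, b⟩, ha, hab, hb⟩ => LinearMap.ext_ring ?_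
    have e : Finsupp.lsingle (M := R) (R := R) (⟨(a, b), ha, hab, hb⟩ : Ref n) 1 = x n R a b := by
      rw [x, dif_pos ⟨ha, hab, hb⟩]
      rfl
    simp only [LinearMap.comp_apply, e]
    rw [sigmaLin_x n q 0 k ha hab hb, hf a b ha hab hb]
  have h' := h
  unfold full at h'
  split_ifs with h1 h2 h3 h4 h5
  · refine key 0 fun a b ha hab hb => ?_
    rw [sigmaX_zero]
    split_ifs <;> simp only [map_add, map_smul, map_zero, coord_x h, LinearMap.zero_apply,
      smul_eq_mul] <;> grind
  · subst h2
    refine key ((1 - q) • coord n (k + 1) j + q • coord n k j) fun a b ha hab hb => ?_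
    have f1 : full n k j := ⟨by omega, by omega, by omega⟩
    rw [sigmaX_zero]
    split_ifs <;> simp only [map_add, map_smul, map_zero, coord_x h, coord_x f1,
      LinearMap.add_apply, LinearMap.smul_apply, smul_eq_mul] <;> grind
  · subst h3
    refine key (coord n (i + 1) j) fun a b ha hab hb => ?_
    have f1 : full n (i + 1) j := ⟨by omega, by omega, by omega⟩
    rw [sigmaX_zero]
    split_ifs <;> simp only [map_add, map_smul, map_zero, coord_x h, coord_x f1,
      smul_eq_mul] <;> grind
  · subst h4
    refine key ((1 - q) • coord n i j + coord n i (j + 1)) fun a b ha hab hb => ?_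
    have f1 : full n i (j + 1) := ⟨by omega, by omega, by omega⟩
    rw [sigmaX_zero]
    split_ifs <;> simp only [map_add, map_smul, map_zero, coord_x h, coord_x f1,
      LinearMap.add_apply, LinearMap.smul_apply, smul_eq_mul] <;> grind
  · subst h5
    refine key (q • coord n i k) fun a b ha hab hb => ?_
    have f1 : full n i k := ⟨by omega, by omega, by omega⟩
    rw [sigmaX_zero]
    split_ifs <;> simp only [map_add, map_smul, map_zero, coord_x h, coord_x f1,
      LinearMap.smul_apply, smul_eq_mul] <;> grind
  · refine key (coord n i j) fun a b ha hab hb => ?_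
    rw [sigmaX_zero]
    split_ifs <;> simp only [map_add, map_smul, map_zero, coord_x h, smul_eq_mul] <;> grind

end Coordinates

/-! ### Vanishing coordinates of nonnegative vectors -/

section Vanishing

variable {n : ℕ}

/-- The set of vanishing coordinates of a vector. -/
def zeros (v : V n ℝ) (i j : ℕ) : Prop := full n i j ∧ coord n i j v = 0

theorem coord_sigmaLin_nonneg {k : ℕ} (hk : 1 ≤ k) (hk' : k + 1 ≤ n) {q : ℝ} (hq₀ : 0 < q)
    (hq₁ : q < 1) {v : V n ℝ} (hv : ∀ i j, 0 ≤ coord n i j v) (i j : ℕ) :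
    0 ≤ coord n i j (sigmaLin n q 0 k v) := by
  by_cases h : full n i j
  · rw [coord_sigmaLin hk hk' q h]
    have := sub_pos.2 hq₁
    have := hv (k + 1) j
    have := hv k j
    have := hv i k
    have := hv i (k + 1)
    have := hv i j
    split_ifs <;> positivity
  · rw [coord, dif_neg h, LinearMap.zero_apply]

theorem mul_add_mul_eq_zero_iff {a b c d : ℝ} (ha : 0 < a) (hb : 0 < b) (hc : 0 ≤ c)
    (hd : 0 ≤ d) : a * c + b * d = 0 ↔ d = 0 ∧ c = 0 := by
  rw [add_eq_zero_iff_of_nonneg (by positivity) (by positivity), mul_eq_zero, mul_eq_zero]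
  simp [ha.ne', hb.ne', and_comm]

/-- A combination of nonnegative numbers with positive coefficients vanishes only if each of them
does; the two-term rows produce the conjunctions in `push`. -/
theorem zeros_sigmaLin {k : ℕ} (hk : 1 ≤ k) (hk' : k + 1 ≤ n) {q : ℝ} (hq₀ : 0 < q)
    (hq₁ : q < 1) {v : V n ℝ} (hv : ∀ i j, 0 ≤ coord n i j v) :
    zeros (sigmaLin n q 0 k v) = push k (zeros v) := by
  funext i j
  have hq₁' := sub_pos.2 hq₁
  by_cases h : full n i j
  · unfold zeros
    rw [coord_sigmaLin hk hk' q h]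
    have e1 := mul_add_mul_eq_zero_iff hq₁' hq₀ (hv (k + 1) j) (hv k j)
    have e2 := mul_add_mul_eq_zero_iff hq₁' one_pos (hv i k) (hv i (k + 1))
    have e3 : q * coord n i k v = 0 ↔ coord n i k v = 0 := by simp [hq₀.ne']
    rw [one_mul] at e2
    unfold push
    unfold full at h ⊢
    apply propext
    split_ifs with h1 h2 h3 h4 h5
    · grind
    · rw [e1]
      grind
    · grind
    · rw [e2]
      grind
    · rw [e3]
      grind
    · grind
  · unfold zeros push
    unfold full at h ⊢
    grind

/-- The vector all of whose coordinates are `1`. -/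
noncomputable def ones (n : ℕ) (R : Type*) [CommRing R] : V n R :=
  have : Finite (Ref n) := (biclosed_full n).finite
  Finsupp.equivFunOnFinite.symm fun _ => 1

theorem mapV_ones {R R' : Type*} [CommRing R] [CommRing R'] (φ : R →+* R') :
    mapV n φ (ones n R) = ones n R' := by
  ext s
  rw [mapV_apply]
  exact map_one φ

open Classical in
theorem coord_ones (i j : ℕ) : coord n i j (ones n ℝ) = if full n i j then 1 else 0 := by
  unfold coord
  split_ifs
  · rfl
  · rfl

theorem wordAct_ones {q : ℝ} (hq₀ : 0 < q) (hq₁ : q < 1) (L : List (Fin (n - 1))) :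
    (∀ i j, 0 ≤ coord n i j (wordAct q 0 L (ones n ℝ))) ∧
      Closed n (zeros (wordAct q 0 L (ones n ℝ))) := by
  induction L with
  | nil =>
    refine ⟨fun i j => ?_, ?_⟩
    · rw [wordAct, coord_ones]
      split_ifs <;> norm_num
    · have : zeros (ones n ℝ) = fun _ _ => False := by
        funext i j
        unfold zeros
        rw [coord_ones]
        split_ifs with h <;> simp [h]
      rw [wordAct, this]
      exact (biclosed_empty n).toClosed
  | cons k L ih =>
    have hk : (k : ℕ) + 1 + 1 ≤ n := by omega
    refine ⟨coord_sigmaLin_nonneg (by omega) hk hq₀ hq₁ ih.1, ?_⟩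
    rw [wordAct, zeros_sigmaLin (by omega) hk hq₀ hq₁ ih.1]
    exact ih.2.push (by omega) hk

theorem zeros_wordAct_cons {q : ℝ} (hq₀ : 0 < q) (hq₁ : q < 1) (k : Fin (n - 1))
    (L : List (Fin (n - 1))) :
    zeros (wordAct q 0 (k :: L) (ones n ℝ)) = push (k + 1) (zeros (wordAct q 0 L (ones n ℝ))) :=
  zeros_sigmaLin (by omega) (by omega) hq₀ hq₁ (wordAct_ones hq₀ hq₁ L).1

/-- The interior of the set of vanishing coordinates of `L • ones` at `t = 0` is the inversion set
of a simple left divisor of `L`. -/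
theorem exists_wordBraid_eq_lift_mul {q : ℝ} (hq₀ : 0 < q) (hq₁ : q < 1)
    (L : List (Fin (n - 1))) : ∃ L', wordBraid L =
      lift n (int (zeros (wordAct q 0 L (ones n ℝ)))) * wordBraid L' := by
  suffices ∃ p ∈ positive n, wordBraid L =
      lift n (int (zeros (wordAct q 0 L (ones n ℝ)))) * p by
    obtain ⟨p, hp, e⟩ := this
    obtain ⟨L', rfl⟩ := exists_wordBraid hp
    exact ⟨L', e⟩
  induction L with
  | nil =>
    refine ⟨1, one_mem _, ?_⟩
    rw [lift_of_forall_not, mul_one]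
    · rfl
    · intro i j h
      have h' := int_le _ _ h
      unfold zeros at h'
      rw [wordAct, coord_ones, if_pos h'.1] at h'
      exact one_ne_zero h'.2
  | cons k L ih =>
    obtain ⟨p, hp, e⟩ := ih
    have hc := (wordAct_ones hq₀ hq₁ L).2
    obtain ⟨p', hp', e'⟩ := hc.biclosed_int.exists_sg_mul_lift (k := k + 1) (by omega) (by omega)
    refine ⟨p' * p, mul_mem hp' hp, ?_⟩
    -- The divisor found is attached to `push` of the interior; `int_push_int` turns it into the one
    -- attached to `push` of the vanishing set itself.
    rw [wordBraid_cons, e, ← mul_assoc, e', zeros_wordAct_cons hq₀ hq₁,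
      int_push_int hc (by omega) (by omega), mul_assoc]

end Vanishing

/-! ### Faithfulness -/

/-- Although `t = 0` is not a specialization of Laurent polynomials, positive words involve only
nonnegative powers of `t`. The equality descends to `ℝ[t]`, which embeds in `ℝ[t^{±1}]`, and can be
evaluated there. -/
theorem wordAct_ones_eq {n : ℕ} (q : ℝˣ) {L L' : List (Fin (n - 1))}
    (h : rep n (laurentConst q) (laurentVar ℝ) (wordBraid L) =
      rep n (laurentConst q) (laurentVar ℝ) (wordBraid L')) :
    wordAct (q : ℝ) 0 L (ones n ℝ) = wordAct (q : ℝ) 0 L' (ones n ℝ) := by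
  have hq : (laurentConst q : ℝ[T;T⁻¹]) = Polynomial.toLaurent (Polynomial.C (q : ℝ)) :=
    (Polynomial.toLaurent_C _).symm
  have ht : (laurentVar ℝ : ℝ[T;T⁻¹]) = Polynomial.toLaurent Polynomial.X :=
    Polynomial.toLaurent_X.symm
  have h1 := LinearEquiv.congr_fun h (ones n _)
  rw [rep_wordBraid, rep_wordBraid, hq, ht, ← mapV_ones Polynomial.toLaurent, ← mapV_wordAct,
    ← mapV_wordAct] at h1
  have h2 := Finsupp.mapRange_injective _ (map_zero _) Polynomial.toLaurent_injective h1
  have h3 := congrArg (mapV n (Polynomial.evalRingHom (0 : ℝ))) h2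
  rwa [mapV_wordAct, mapV_wordAct, mapV_ones, Polynomial.coe_evalRingHom, Polynomial.eval_C,
    Polynomial.eval_X] at h3

theorem wordBraid_eq_of_rep_eq {n : ℕ} (q : ℝˣ) (hq₀ : 0 < (q : ℝ)) (hq₁ : (q : ℝ) < 1)
    {L L' : List (Fin (n - 1))}
    (h : rep n (laurentConst q) (laurentVar ℝ) (wordBraid L) =
      rep n (laurentConst q) (laurentVar ℝ) (wordBraid L')) : wordBraid L = wordBraid L' := by
  induction hm : L.length using Nat.strong_induction_on generalizing L L' with
  | _ m ih =>
    have hw := wordAct_ones_eq q h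
    obtain ⟨M, hM⟩ := exists_wordBraid_eq_lift_mul hq₀ hq₁ L
    obtain ⟨M', hM'⟩ := exists_wordBraid_eq_lift_mul hq₀ hq₁ L'
    rw [← hw] at hM'
    have hB := (wordAct_ones hq₀ hq₁ L).2.biclosed_int
    by_cases he : ∃ i j, int (zeros (wordAct (q : ℝ) 0 L (ones n ℝ))) i j
    · obtain ⟨i, j, hij⟩ := he
      obtain ⟨k, hk⟩ := hB.exists_simple hij
      obtain ⟨N, hN⟩ := exists_wordBraid (hB.peel hk).lift_mem_positive
      have hlt : M.length < m := by
        have hb := hB.bound hk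
        obtain ⟨k, rfl⟩ : ∃ k', k = k' + 1 := ⟨k - 1, by omega⟩
        rw [hB.lift_eq hk, hN, ← wordBraid_cons ⟨k, by omega⟩, ← wordBraid_append] at hM
        have := length_eq_of_wordBraid_eq hM
        rw [List.length_append, List.length_cons] at this
        omega
      rw [hM, hM', map_mul, map_mul] at h
      rw [hM, hM', ih _ hlt (mul_left_cancel h) rfl]
    · have nil_of : ∀ K : List (Fin (n - 1)),
          wordAct (q : ℝ) 0 L (ones n ℝ) = wordAct (q : ℝ) 0 K (ones n ℝ) → K = [] := by
        rintro (_ | ⟨k, K⟩) hK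
        · rfl
        · rw [hK, zeros_wordAct_cons hq₀ hq₁] at he
          exact absurd ⟨_, _, int_push_simple _ _⟩ he
      rw [nil_of L rfl, nil_of L' hw]

theorem rep_real_injective (n : ℕ) (q : ℝˣ) (hq₀ : 0 < (q : ℝ)) (hq₁ : (q : ℝ) < 1) :
    Function.Injective (rep n (laurentConst q) (laurentVar ℝ)) := by
  rw [injective_iff_map_eq_one]
  intro g hg
  obtain ⟨y, hy, z, hz, rfl⟩ := exists_positive_fraction g
  obtain ⟨L, rfl⟩ := exists_wordBraid hy
  obtain ⟨L', rfl⟩ := exists_wordBraid hz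
  rw [map_mul, map_inv, mul_inv_eq_one] at hg
  rw [mul_inv_eq_one]
  exact wordBraid_eq_of_rep_eq q hq₀ hq₁ hg

theorem rep_int_injective (n : ℕ) :
    Function.Injective (rep n (laurentConst (laurentVar ℤ)) (laurentVar ℤ[T;T⁻¹])) := by
  -- Any real number strictly between `0` and `1` would do as the value of `q`.
  let r : ℝˣ := Units.mk0 2⁻¹ (by norm_num)
  let φ : ℤ[T;T⁻¹][T;T⁻¹] →+* ℝ[T;T⁻¹] :=
    LaurentPolynomial.eval₂ (LaurentPolynomial.eval₂ (Int.castRingHom _) (laurentConst r))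
      (laurentVar ℝ)
  apply rep_injective_of_map n φ
  have e1 : Units.map φ.toMonoidHom (laurentConst (laurentVar ℤ)) = laurentConst r := by
    ext1
    change φ (LaurentPolynomial.C (LaurentPolynomial.T 1)) = _
    rw [LaurentPolynomial.eval₂_C, LaurentPolynomial.eval₂_T, zpow_one]
  have e2 : Units.map φ.toMonoidHom (laurentVar ℤ[T;T⁻¹]) = laurentVar ℝ := by
    ext1
    change φ (LaurentPolynomial.T 1) = _
    rw [LaurentPolynomial.eval₂_T, zpow_one]
  rw [e1, e2]
  exact rep_real_injective n r (by simp [r]) (by simp only [r, Units.val_mk0]; norm_num)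

end Krammer

theorem theorem3p2 (n : ℕ) (hn : 1 ≤ n) :
    -- `R = ℝ[t^{±1}]` and `q` a real number with `0 < q < 1`
    (∀ (q : ℝ) (hq₀ : 0 < q), q < 1 →
      Function.Injective
        (Krammer.rep (R := ℝ[T;T⁻¹]) n
          (Krammer.laurentConst (Units.mk0 q hq₀.ne')) (Krammer.laurentVar ℝ))) ∧
    -- `R = ℤ[q^{±1}, t^{±1}]`, written as `(ℤ[q^{±1}])[t^{±1}]`
    Function.Injective
      (Krammer.rep (R := ℤ[T;T⁻¹][T;T⁻¹]) n
        (Krammer.laurentConst (Krammer.laurentVar ℤ)) (Krammer.laurentVar ℤ[T;T⁻¹])) := by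
  exact ⟨fun q hq₀ hq₁ => Krammer.rep_real_injective n (Units.mk0 q hq₀.ne') hq₀ hq₁,
      Krammer.rep_int_injective n⟩
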